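/- **Conventions.** A *superringed space* is a topological space with a sheaf of $\mathbb Z_2$-graded $\mathbb R$-algebras; morphisms are continuous maps together with parity-preserving morphisms of sheaves of algebras above them. A *supermanifold* is a superringed space whose underlying space is Hausdorff and second countable and which is locally isomorphic to $\mathbb R^{p|q}$ for fixed $p,q$. For a supermanifold $M$ with local coordinates $(x^a)$, the tangent bundle $\mathsf TM$ and the cotangent bundle $\mathsf T^*M$ are the supermanifolds glued from the coordinate systems $(x^a,\dot x^a)$, respectively $(x^a,p_a)$, where $\dot x^a$ and $p_a$ have the parity of $x^a$ and $$\dot x^{a'}=\dot x^b\,\frac{\partial x^{a'}}{\partial x^b},\qquad p_{a'}=\frac{\partial x^b}{\partial x^{a'}}\,p_b .$$ Let $L$ be a Lagrangian on $M$, that is, an even function on $\mathsf TM$. Its differential is the morphism $dL:\mathsf TM\to\mathsf T^*\mathsf TM$ given, in the coordinates $(x^a,\dot x^a,q_a,r_a)$ of $\mathsf T^*\mathsf TM$ with $q_a,r_a$ the momenta of $\partial/\partial x^a,\partial/\partial\dot x^a$, by $(x,\dot x,q,r)\circ dL=(x,\dot x,\partial L/\partial x,\partial L/\partial\dot x)$.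 The canonical isomorphism $\alpha:\mathsf T\mathsf T^*M\to\mathsf T^*\mathsf TM$ is given by $(x,\dot x,q,r)\circ\alpha=(x,\dot x,\dot p,p)$ in the coordinates $(x,p,\dot x,\dot p)$ of $\mathsf T\mathsf T^*M$. Put $\mathcal TL:=\alpha^{-1}\circ dL:\mathsf TM\to\mathsf T\mathsf T^*M$. For a supermanifold $S$, the phase dynamics at $S$ is the set of $S$-points $$\mathcal D(S):=\{\mathcal TL\circ m \mid m\in\mathrm{Hom}(S,\mathsf TM)\}\subset\mathrm{Hom}(S,\mathsf T\mathsf T^*M).$$ An $S$-curve in a supermanifold $N$ is a morphism $c:S\times\mathbb R\to N$; its tangent prolongation is the morphism $\mathsf tc:S\times\mathbb R\to\mathsf TN$ with $(x^a,\dot x^a)\circ\mathsf tc=(x^a\circ c,\ \tfrac{d}{dt}(x^a\circ c))$ in local coordinates of $N$, functions on $S$ being constant in time, and $\mathsf tc(t):S\to\mathsf TN$ is its restriction to $S\times\{t\}$. An $S$-curve $c$ in $\mathsf T^*M$ is a *solution of the phase dynamics at $S$* if $\mathsf tc(t)\in\mathcal D(S)$ for all $t\in\mathbb R$. **Proposition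 3.1.** Let $M$ be a supermanifold, $L$ a Lagrangian on $M$, and $S,P$ supermanifolds. If $c_S:S\times\mathbb R\to\mathsf T^*M$ is a solution of the phase dynamics at $S$, then for every morphism $\psi:P\to S$ the $P$-curve $$c_P:=c_S\circ(\psi\times\mathbb 1_{\mathbb R}):P\times\mathbb R\to\mathsf T^*M$$ is a solution of the phase dynamics at $P$. -/

import Mathlib

open TopologicalSpace CategoryTheory
open scoped ContDiff

namespace SuperMech

noncomputable section

/-! ## Grassmann algebras and smooth Grassmann-valued functions -/

/-- The Grassmann algebra with odd generators indexed by `J`. -/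
abbrev Grassmann (J : Type) : Type := ExteriorAlgebra ℝ (J → ℝ)

instance grassmannFinite (J : Type) [Fintype J] : Module.Finite ℝ (Grassmann J) := by
  classical
  let o : LinearOrder J := linearOrderOfSTO WellOrderingRel
  exact Module.Finite.of_basis (Pi.basisFun ℝ J).ExteriorAlgebra

/-- The parity involution: `1` on even elements and `-1` on odd ones. -/
def grassmannParity (J : Type) : Grassmann J →ₐ[ℝ] Grassmann J :=
  ExteriorAlgebra.map (-LinearMap.id)

theorem grassmannParity_parity (J : Type) (a : Grassmann J) :
    grassmannParity J (grassmannParity J a) = a := by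
  have h : (grassmannParity J).comp (grassmannParity J) = AlgHom.id ℝ _ := by
    unfold grassmannParity
    rw [ExteriorAlgebra.map_comp_map]
    convert ExteriorAlgebra.map_id (R := ℝ) (M := J → ℝ) using 2
    ext; simp
  exact DFunLike.congr_fun h a

/-- A function with values in a (finite-dimensional) Grassmann algebra is smooth on a set if all its
components are. -/
def SmoothOn {E : Type} [NormedAddCommGroup E] [NormedSpace ℝ E] {J : Type}
    (F : E → Grassmann J) (A : Set E) : Prop :=
  ∀ l : Module.Dual ℝ (Grassmann J), ContDiffOn ℝ ∞ (fun x => l (F x)) A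

section smooth

variable {E : Type} [NormedAddCommGroup E] [NormedSpace ℝ E] {J K : Type} {A : Set E}

theorem SmoothOn.congr {F G : E → Grassmann J} (hF : SmoothOn F A) (h : ∀ x ∈ A, G x = F x) :
    SmoothOn G A := fun l => (hF l).congr fun x hx => by simp only [h x hx]

theorem SmoothOn.const (a : Grassmann J) : SmoothOn (fun _ : E => a) A :=
  fun _ => contDiffOn_const

theorem SmoothOn.add {F G : E → Grassmann J} (hF : SmoothOn F A) (hG : SmoothOn G A) :
    SmoothOn (fun x => F x + G x) A := fun l => by
  simpa only [map_add] using (hF l).add (hG l)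

theorem SmoothOn.linear {F : E → Grassmann J} (hF : SmoothOn F A)
    (T : Grassmann J →ₗ[ℝ] Grassmann K) : SmoothOn (fun x => T (F x)) A :=
  fun l => hF (l.comp T)

theorem SmoothOn.smul {c : E → ℝ} {F : E → Grassmann J} (hc : ContDiffOn ℝ ∞ c A)
    (hF : SmoothOn F A) : SmoothOn (fun x => c x • F x) A := fun l => by
  simp only [map_smul]
  exact hc.smul (hF l)

theorem SmoothOn.sum {ι : Type*} {s : Finset ι} {F : ι → E → Grassmann J}
    (hF : ∀ i ∈ s, SmoothOn (F i) A) : SmoothOn (fun x => ∑ i ∈ s, F i x) A := fun l => by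
  simpa only [map_sum] using ContDiffOn.sum fun i hi => hF i hi l

theorem SmoothOn.mul [Fintype J] {F G : E → Grassmann J} (hF : SmoothOn F A) (hG : SmoothOn G A) :
    SmoothOn (fun x => F x * G x) A := by
  let b := Module.finBasis ℝ (Grassmann J)
  have : (fun x => F x * G x) = fun x => ∑ i, (b.coord i (F x)) • (b i * G x) := by
    funext x
    conv_lhs => rw [← b.sum_repr (F x), Finset.sum_mul]
    exact Finset.sum_congr rfl fun i _ => smul_mul_assoc _ _ _
  rw [this]
  exact SmoothOn.sum fun i _ =>
    SmoothOn.smul (hF (b.coord i)) (hG.linear (LinearMap.mulLeft ℝ (b i)))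

end smooth

open Classical in
/-- Extension by zero of a function on an open set. -/
def extendZero {E : Type} [TopologicalSpace E] {J : Type} {U : Opens E} (f : U → Grassmann J) :
    E → Grassmann J := fun x => if h : x ∈ U then f ⟨x, h⟩ else 0

theorem extendZero_of_mem {E : Type} [TopologicalSpace E] {J : Type} {U : Opens E}
    (f : U → Grassmann J) {x : E} (h : x ∈ U) : extendZero f x = f ⟨x, h⟩ := dif_pos h

/-! ## Superringed spaces -/

/-- A topological space with a sheaf of `ℤ/2`-graded `ℝ`-algebras. The grading is recorded by the
parity involution: a section `f` is even if `parity f = f` and odd if `parity f = -f`. -/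
structure SuperSpace where
  carrier : Type
  [top : TopologicalSpace carrier]
  sec : Opens carrier → Type
  [ring : ∀ U, Ring (sec U)]
  [algebra : ∀ U, Algebra ℝ (sec U)]
  parity : ∀ U, sec U →ₐ[ℝ] sec U
  parity_parity : ∀ U (f : sec U), parity U (parity U f) = f
  res : ∀ {U V : Opens carrier}, V ≤ U → sec U →ₐ[ℝ] sec V
  res_self : ∀ {U : Opens carrier} (h : U ≤ U) (f : sec U), res h f = f
  res_res : ∀ {U V W : Opens carrier} (h : V ≤ U) (h' : W ≤ V) (f : sec U),
    res h' (res h f) = res (h'.trans h) f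
  res_parity : ∀ {U V : Opens carrier} (h : V ≤ U) (f : sec U),
    res h (parity U f) = parity V (res h f)
  locality : ∀ {U : Opens carrier} (f g : sec U),
    (∀ x ∈ U, ∃ (V : Opens carrier) (h : V ≤ U), x ∈ V ∧ res h f = res h g) → f = g
  gluing : ∀ {U : Opens carrier} {κ : Type} (V : κ → Opens carrier) (hV : ∀ k, V k ≤ U)
    (_ : ∀ x ∈ U, ∃ k, x ∈ V k) (s : ∀ k, sec (V k)),
    (∀ k l, res (inf_le_left : V k ⊓ V l ≤ V k) (s k) =
      res (inf_le_right : V k ⊓ V l ≤ V l) (s l)) → ∃ f : sec U, ∀ k, res (hV k) f = s k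

attribute [instance] SuperSpace.top SuperSpace.ring SuperSpace.algebra

/-- Two sections are the same: they have the same domain and are equal. -/
def SuperSpace.Same (X : SuperSpace) {U V : Opens X.carrier} (f : X.sec U) (g : X.sec V) : Prop :=
  ∃ h : V = U, X.res h.le f = g

theorem comapLe {X Y : Type} [TopologicalSpace X] [TopologicalSpace Y] (f : C(X, Y))
    {U V : Opens Y} (h : V ≤ U) : V.comap f ≤ U.comap f := fun _ hx => h hx

/-- A morphism of superringed spaces: a continuous map together with a morphism of sheaves of
superalgebras above it. -/
structure SuperHom (X Y : SuperSpace) where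
  base : C(X.carrier, Y.carrier)
  pull : ∀ U : Opens Y.carrier, Y.sec U →ₐ[ℝ] X.sec (U.comap base)
  pull_res : ∀ {U V : Opens Y.carrier} (h : V ≤ U) (f : Y.sec U),
    pull V (Y.res h f) = X.res (comapLe base h) (pull U f)
  pull_parity : ∀ (U : Opens Y.carrier) (f : Y.sec U),
    pull U (Y.parity U f) = X.parity _ (pull U f)

instance : Category SuperSpace where
  Hom := SuperHom
  id X :=
    { base := ContinuousMap.id _
      pull := fun U => AlgHom.id ℝ (X.sec U)
      pull_res := fun _ _ => rfl
      pull_parity := fun _ _ => rfl }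
  comp {X Y Z} F G :=
    { base := G.base.comp F.base
      pull := fun U => (F.pull (U.comap G.base)).comp (G.pull U)
      pull_res := fun {_ V} h f =>
        (congrArg (F.pull (V.comap G.base)) (G.pull_res h f)).trans (F.pull_res _ _)
      pull_parity := fun U f =>
        (congrArg (F.pull (U.comap G.base)) (G.pull_parity U f)).trans (F.pull_parity _ _) }

theorem same_of_hom_eq {X Y : SuperSpace} {F G : X ⟶ Y} (h : F = G) {U : Opens Y.carrier}
    (f : Y.sec U) {V : Opens X.carrier} (hF : V ≤ U.comap F.base) (hG : V ≤ U.comap G.base) :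
    X.res hF (F.pull U f) = X.res hG (G.pull U f) := by
  subst h; rfl

/-! ## The superspaces `ℝ^{I|J}` -/

section model

variable (I J : Type) [Fintype I] [Fintype J]

variable {I} in
/-- Superfunctions on an open subset of `ℝ^I`: smooth functions with values in the Grassmann
algebra, that is, polynomials in the odd coordinates with smooth coefficients. -/
def superFun (U : Opens (I → ℝ)) : Subalgebra ℝ (U → Grassmann J) where
  carrier := {f | SmoothOn (extendZero f) U}
  mul_mem' {f g} hf hg := (SmoothOn.mul hf hg).congr fun x hx => by
    simp only [extendZero_of_mem _ (show x ∈ U from hx), Pi.mul_apply]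
  add_mem' {f g} hf hg := (SmoothOn.add hf hg).congr fun x hx => by
    simp only [extendZero_of_mem _ (show x ∈ U from hx), Pi.add_apply]
  algebraMap_mem' r := (SmoothOn.const (algebraMap ℝ _ r)).congr fun x hx => by
    rw [extendZero_of_mem _ (show x ∈ U from hx)]; rfl

variable {I J} in
theorem mem_superFun {U : Opens (I → ℝ)} {f : U → Grassmann J} :
    f ∈ superFun J U ↔ SmoothOn (extendZero f) U := Iff.rfl

/-- The superspace `ℝ^{I|J}`. -/
def Model : SuperSpace where
  carrier := I → ℝ
  sec U := superFun J U
  parity U :=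
    ((((grassmannParity J).compLeft U)).comp (superFun J U).val).codRestrict (superFun J U)
      fun f => (SmoothOn.linear f.2 (grassmannParity J).toLinearMap).congr fun x hx => by
        simp only [extendZero_of_mem _ (show x ∈ U from hx)]; rfl
  parity_parity U f := Subtype.ext (funext fun x => grassmannParity_parity J _)
  res {U V} h :=
    { toFun := fun f => ⟨fun x => f.1 ⟨x.1, h x.2⟩, fun l =>
        ((f.2 l).mono h).congr fun x hx => by
          rw [extendZero_of_mem _ (show x ∈ V from hx), extendZero_of_mem _ (h hx)]⟩
      map_one' := rfl
      map_mul' := fun _ _ => rfl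
      map_zero' := rfl
      map_add' := fun _ _ => rfl
      commutes' := fun _ => rfl }
  res_self _ _ := rfl
  res_res _ _ _ := rfl
  res_parity _ _ := rfl
  locality {U} f g H := by
    refine Subtype.ext (funext fun x => ?_)
    obtain ⟨V, h, hx, e⟩ := H x.1 x.2
    exact congrFun (congrArg Subtype.val e) ⟨x.1, hx⟩
  gluing {U κ} V hV cov s hs := by
    choose k hk using cov
    have key : ∀ (x : I → ℝ) (hx : x ∈ U) (l : κ) (hl : x ∈ V l),
        (s (k x hx)).1 ⟨x, hk x hx⟩ = (s l).1 ⟨x, hl⟩ := fun x hx l hl =>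
      congrFun (congrArg Subtype.val (hs (k x hx) l)) ⟨x, hk x hx, hl⟩
    refine ⟨⟨fun x => (s (k x.1 x.2)).1 ⟨x.1, hk x.1 x.2⟩, fun m x hx => ?_⟩,
      fun l => Subtype.ext (funext fun x => key x.1 (hV l x.2) l x.2)⟩
    have h1 := ((s (k x hx)).2 m).contDiffAt ((V (k x hx)).isOpen.mem_nhds (hk x hx))
    refine (h1.congr_of_eventuallyEq ?_).contDiffWithinAt
    filter_upwards [(V (k x hx)).isOpen.mem_nhds (hk x hx)] with y hy
    rw [extendZero_of_mem _ (hV _ hy), extendZero_of_mem _ hy]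
    exact congrArg m (key y (hV _ hy) _ hy)

variable {I J}

open Classical in
/-- The coordinate functions of `ℝ^{I|J}`: even ones indexed by `I` and odd ones indexed by `J`. -/
def coord (U : Opens (I → ℝ)) : I ⊕ J → (Model I J).sec U
  | Sum.inl i => ⟨fun x => algebraMap ℝ _ (x.1 i), fun l => by
      have h : ContDiffOn ℝ ∞ (fun x : I → ℝ => x i • l 1) U :=
        ((contDiff_apply ℝ ℝ i).contDiffOn).smul contDiffOn_const
      refine h.congr fun x hx => ?_
      rw [extendZero_of_mem _ (show x ∈ U from hx), Algebra.algebraMap_eq_smul_one, map_smul]⟩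
  | Sum.inr j => ⟨fun _ => ExteriorAlgebra.ι ℝ (Pi.single (M := fun _ => ℝ) j 1),
      (SmoothOn.const (ExteriorAlgebra.ι ℝ (Pi.single (M := fun _ => ℝ) j 1))).congr fun x hx => by
        rw [extendZero_of_mem _ (show x ∈ U from hx)]⟩

/-- The underlying Grassmann-valued function of a section of `ℝ^{I|J}`. -/
def modelFun {U : Opens (I → ℝ)} (f : (Model I J).sec U) : U → Grassmann J :=
  Subtype.val (p := (· ∈ superFun J U)) f

theorem modelFun_smooth {U : Opens (I → ℝ)} (f : (Model I J).sec U) :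
    SmoothOn (extendZero (modelFun f)) U :=
  Subtype.property (p := (· ∈ superFun J U)) f

open Classical in
/-- The partial derivatives on `ℝ^{I|J}`: with respect to an even coordinate the components are
differentiated, and with respect to an odd coordinate it is the left derivative, the odd derivation
that contracts with the dual of the generator. -/
def partialDeriv {U : Opens (I → ℝ)} (f : (Model I J).sec U) : I ⊕ J → (Model I J).sec U
  | Sum.inl i => ⟨fun x => ∑ k, (fderiv ℝ (fun y => (Module.finBasis ℝ (Grassmann J)).coord k
        (extendZero (modelFun f) y)) x.1 (Pi.single (M := fun _ => ℝ) i 1)) •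
          Module.finBasis ℝ (Grassmann J) k,
      (SmoothOn.sum (s := Finset.univ)
        (F := fun k (x : I → ℝ) => (fderiv ℝ (fun y => (Module.finBasis ℝ (Grassmann J)).coord k
          (extendZero (modelFun f) y)) x (Pi.single (M := fun _ => ℝ) i 1)) •
            Module.finBasis ℝ (Grassmann J) k)
        fun k _ => SmoothOn.smul
          (((modelFun_smooth f ((Module.finBasis ℝ (Grassmann J)).coord k)).fderiv_of_isOpen
            U.isOpen (m := ∞) (by simp)).clm_apply contDiffOn_const)
          (SmoothOn.const _)).congr fun x hx => by
            rw [extendZero_of_mem _ (show x ∈ U from hx)]⟩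
  | Sum.inr j => ⟨fun x => CliffordAlgebra.contractLeft
        (Q := (0 : QuadraticForm ℝ (J → ℝ))) (LinearMap.proj j) (modelFun f x),
      (SmoothOn.linear (modelFun_smooth f) (CliffordAlgebra.contractLeft
        (Q := (0 : QuadraticForm ℝ (J → ℝ))) (LinearMap.proj j))).congr fun x hx => by
          rw [extendZero_of_mem _ (show x ∈ U from hx), extendZero_of_mem _ (show x ∈ U from hx)]⟩

/-- The inclusion of the Grassmann algebra on `J` into the one on two copies of `J`, onto the first
copy. -/
def grassmannInl (J : Type) : Grassmann J →ₐ[ℝ] Grassmann (J ⊕ J) :=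
  ExteriorAlgebra.map
    { toFun := fun v => Sum.elim v 0
      map_add' := fun v w => by ext (j | j) <;> simp
      map_smul' := fun r v => by ext (j | j) <;> simp }

theorem grassmannInl_parity (J : Type) (a : Grassmann J) :
    grassmannInl J (grassmannParity J a) = grassmannParity (J ⊕ J) (grassmannInl J a) := by
  have h : (grassmannInl J).comp (grassmannParity J) =
      (grassmannParity (J ⊕ J)).comp (grassmannInl J) := by
    unfold grassmannParity grassmannInl
    rw [ExteriorAlgebra.map_comp_map, ExteriorAlgebra.map_comp_map]
    congr 1
    refine LinearMap.ext fun v => funext fun j => ?_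
    rcases j with j | j <;> simp
  exact DFunLike.congr_fun h a

variable (I J) in
/-- The projection of `ℝ^{2I|2J}` onto the first half of its coordinates. -/
def doubleProj : Model (I ⊕ I) (J ⊕ J) ⟶ Model I J where
  base := ⟨fun (z : I ⊕ I → ℝ) (i : I) => z (Sum.inl i), by fun_prop⟩
  pull U :=
    { toFun := fun f => ⟨fun z => grassmannInl J (modelFun f ⟨fun i => z.1 (Sum.inl i), z.2⟩),
        fun l => by
          have h1 := modelFun_smooth f (l.comp (grassmannInl J).toLinearMap)
          have h2 : ContDiff ℝ ∞ (fun (z : I ⊕ I → ℝ) (i : I) => z (Sum.inl i)) := by fun_prop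
          refine (h1.comp h2.contDiffOn fun z hz => hz).congr fun z hz => ?_
          exact congrArg l ((extendZero_of_mem (E := I ⊕ I → ℝ) _ hz).trans
            (congrArg (grassmannInl J)
              (extendZero_of_mem (modelFun f) (x := fun i => z (Sum.inl i)) hz).symm))⟩
      map_one' := Subtype.ext (funext fun _ => map_one (grassmannInl J))
      map_mul' := fun _ _ => Subtype.ext (funext fun _ => map_mul (grassmannInl J) _ _)
      map_zero' := Subtype.ext (funext fun _ => map_zero (grassmannInl J))
      map_add' := fun _ _ => Subtype.ext (funext fun _ => map_add (grassmannInl J) _ _)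
      commutes' := fun r => Subtype.ext (funext fun _ => (grassmannInl J).commutes r) }
  pull_res _ _ := rfl
  pull_parity _ _ := Subtype.ext (funext fun _ => grassmannInl_parity J _)

end model

/-! ## Supermanifolds, charts and vector fields -/

/-- A coordinate system on an open part of `X`: an isomorphism of `ℝ^{I|J}` onto an open part
of `X`. -/
structure Chart (I J : Type) [Fintype I] [Fintype J] (X : SuperSpace) where
  hom : Model I J ⟶ X
  isOpenEmbedding : Topology.IsOpenEmbedding hom.base
  bijective : ∀ U : Opens X.carrier, (U : Set X.carrier) ⊆ Set.range hom.base →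
    Function.Bijective (hom.pull U)

/-- A supermanifold of dimension `evenDim|oddDim`: a superringed space with Hausdorff second
countable body which is locally isomorphic to `ℝ^{evenDim|oddDim}`. -/
structure Supermanifold where
  space : SuperSpace
  evenDim : ℕ
  oddDim : ℕ
  t2 : T2Space space.carrier
  secondCountable : SecondCountableTopology space.carrier
  exists_chart : ∀ x : space.carrier, ∃ φ : Chart (Fin evenDim) (Fin oddDim) space,
    x ∈ Set.range φ.hom.base

/-- A homogeneous vector field on the open set `U`: an even or odd derivation of the structure
sheaf. -/
structure VectorField (X : SuperSpace) (U : Opens X.carrier) where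
  odd : Bool
  app : ∀ V : Opens X.carrier, V ≤ U → X.sec V →ₗ[ℝ] X.sec V
  app_res : ∀ {V W : Opens X.carrier} (hV : V ≤ U) (h : W ≤ V) (f : X.sec V),
    app W (h.trans hV) (X.res h f) = X.res h (app V hV f)
  app_parity : ∀ (V : Opens X.carrier) (hV : V ≤ U) (f : X.sec V),
    app V hV (X.parity V f) =
      if odd then -X.parity V (app V hV f) else X.parity V (app V hV f)
  leibniz : ∀ (V : Opens X.carrier) (hV : V ≤ U) (f g : X.sec V),
    app V hV (f * g) = app V hV f * g + (if odd then X.parity V f else f) * app V hV g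

section charts

variable {I J : Type} [Fintype I] [Fintype J] {X : SuperSpace}

/-- The domain in `X` of a chart. -/
def Chart.domain (φ : Chart I J X) : Opens X.carrier :=
  ⟨Set.range φ.hom.base, φ.isOpenEmbedding.isOpen_range⟩

/-- The coordinate functions of a chart, as sections of the structure sheaf over its domain. -/
def Chart.coordFun (φ : Chart I J X) (a : I ⊕ J) : X.sec φ.domain :=
  Function.surjInv (φ.bijective φ.domain subset_rfl).2 (coord _ a)

/-- The components `Y^a = Y(x^a)` of a vector field `Y` in a chart. -/
def Chart.component (φ : Chart I J X) {U : Opens X.carrier} (Y : VectorField X U) (a : I ⊕ J) :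
    (Model I J).sec (U.comap φ.hom.base) :=
  (Model I J).res (show U.comap φ.hom.base ≤ (U ⊓ φ.domain).comap φ.hom.base from
      fun x hx => ⟨hx, x, rfl⟩)
    (φ.hom.pull (U ⊓ φ.domain) (Y.app _ inf_le_left (X.res inf_le_right (φ.coordFun a))))

end charts

/-! ## Gluing -/

section glue

variable (κ : Type) (Z : SuperSpace) (rel : κ → κ → (Z ⟶ Z) → Prop)

/-- The body of the space obtained from copies of `Z` indexed by `κ` by gluing along the transition
morphisms `Φ` from the `k`-th to the `l`-th copy with `rel k l Φ`. -/
def GlueBody : Type :=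
  Quot fun a b : κ × Z.carrier => ∃ Φ : Z ⟶ Z, rel a.1 b.1 Φ ∧ Φ.base a.2 = b.2

/-- The quotient topology of the disjoint union of the bodies of the pieces. -/
instance glueTop : TopologicalSpace (GlueBody κ Z rel) :=
  ⨆ k, TopologicalSpace.coinduced (fun z : Z.carrier => Quot.mk _ (k, z)) inferInstance

variable {κ} in
/-- The body map of the `k`-th piece. -/
def glueMk (k : κ) : C(Z.carrier, GlueBody κ Z rel) :=
  ⟨fun z => Quot.mk _ (k, z), continuous_iff_coinduced_le.2
    (le_iSup (fun k => TopologicalSpace.coinduced (fun z : Z.carrier =>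
      (Quot.mk _ (k, z) : GlueBody κ Z rel)) inferInstance) k)⟩

variable {κ Z rel}

theorem glueMk_trans {k l : κ} {Φ : Z ⟶ Z} (h : rel k l Φ) (z : Z.carrier) :
    glueMk Z rel l (Φ.base z) = glueMk Z rel k z :=
  (Quot.sound ⟨Φ, h, rfl⟩).symm

theorem glue_le {k l : κ} {Φ : Z ⟶ Z} (h : rel k l Φ) (W : Opens (GlueBody κ Z rel)) :
    W.comap (glueMk Z rel k) ≤ (W.comap (glueMk Z rel l)).comap Φ.base := fun z hz => by
  change glueMk Z rel l (Φ.base z) ∈ W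
  rw [glueMk_trans h]
  exact hz

/-- Sections over the glued space: families of sections over the pieces which are matched by all
transition morphisms. -/
def glueSec (W : Opens (GlueBody κ Z rel)) :
    Subalgebra ℝ (∀ k : κ, Z.sec (W.comap (glueMk Z rel k))) where
  carrier := {f | ∀ (k l : κ) (Φ : Z ⟶ Z) (h : rel k l Φ),
    Z.res (glue_le h W) (Φ.pull _ (f l)) = f k}
  mul_mem' {f g} hf hg k l Φ h := by
    simp only [Pi.mul_apply, map_mul, hf k l Φ h, hg k l Φ h]
  add_mem' {f g} hf hg k l Φ h := by
    simp only [Pi.add_apply, map_add, hf k l Φ h, hg k l Φ h]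
  algebraMap_mem' r k l Φ h := by
    simp only [Pi.algebraMap_apply, AlgHom.commutes]

variable (κ Z rel) in
/-- The superringed space obtained by gluing copies of `Z` along transition morphisms. -/
def glue : SuperSpace where
  carrier := GlueBody κ Z rel
  sec W := glueSec W
  parity W :=
    { toFun := fun f => ⟨fun k => Z.parity _ (f.1 k), fun k l Φ h => by
        rw [Φ.pull_parity, Z.res_parity, f.2 k l Φ h]⟩
      map_one' := Subtype.ext (funext fun _ => map_one (Z.parity _))
      map_mul' := fun _ _ => Subtype.ext (funext fun _ => map_mul (Z.parity _) _ _)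
      map_zero' := Subtype.ext (funext fun _ => map_zero (Z.parity _))
      map_add' := fun _ _ => Subtype.ext (funext fun _ => map_add (Z.parity _) _ _)
      commutes' := fun r => Subtype.ext (funext fun _ => (Z.parity _).commutes r) }
  parity_parity W f := Subtype.ext (funext fun k => Z.parity_parity _ _)
  res {W W'} hW :=
    { toFun := fun f => ⟨fun k => Z.res (comapLe (glueMk Z rel k) hW) (f.1 k), fun k l Φ h => by
        have h1 := f.2 k l Φ h
        rw [Φ.pull_res, Z.res_res]
        change _ = Z.res (comapLe (glueMk Z rel k) hW) (f.1 k)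
        rw [← h1, Z.res_res]⟩
      map_one' := Subtype.ext (funext fun _ => map_one (Z.res _))
      map_mul' := fun _ _ => Subtype.ext (funext fun _ => map_mul (Z.res _) _ _)
      map_zero' := Subtype.ext (funext fun _ => map_zero (Z.res _))
      map_add' := fun _ _ => Subtype.ext (funext fun _ => map_add (Z.res _) _ _)
      commutes' := fun r => Subtype.ext (funext fun _ => (Z.res _).commutes r) }
  res_self h f := Subtype.ext (funext fun k => Z.res_self _ _)
  res_res h h' f := Subtype.ext (funext fun k => Z.res_res _ _ _)
  res_parity h f := Subtype.ext (funext fun k => Z.res_parity _ _)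
  locality {W} f g H := by
    refine Subtype.ext (funext fun k => Z.locality _ _ fun z hz => ?_)
    obtain ⟨V, h, hx, e⟩ := H (glueMk Z rel k z) hz
    exact ⟨V.comap (glueMk Z rel k), comapLe _ h, hx, congrFun (congrArg Subtype.val e) k⟩
  gluing {W μ} V hV cov s hs := by
    have ex : ∀ k, ∃ f : Z.sec (W.comap (glueMk Z rel k)), ∀ m,
        Z.res (comapLe (glueMk Z rel k) (hV m)) f = (s m).1 k := fun k =>
      Z.gluing (fun m => (V m).comap (glueMk Z rel k)) (fun m => comapLe _ (hV m))
        (fun z hz => cov _ hz) (fun m => (s m).1 k)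
        (fun m n => congrFun (congrArg Subtype.val (hs m n)) k)
    choose f hf using ex
    refine ⟨⟨f, fun k l Φ h => Z.locality _ _ fun z hz => ?_⟩,
      fun m => Subtype.ext (funext fun k => hf k m)⟩
    obtain ⟨m, hm⟩ := cov _ hz
    refine ⟨(V m).comap (glueMk Z rel k), comapLe _ (hV m), hm, ?_⟩
    have h1 := (s m).2 k l Φ h
    rw [← hf k m, ← hf l m, Φ.pull_res, Z.res_res] at h1
    rw [Z.res_res]
    exact h1

section desc

variable {X : SuperSpace} (F : κ → (Z ⟶ X))
    (hF : ∀ (k l : κ) (Φ : Z ⟶ Z), rel k l Φ → Φ ≫ F l = F k)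

/-- The continuous map out of a glued body given by a compatible family of morphisms. -/
def glueDescBase : C(GlueBody κ Z rel, X.carrier) where
  toFun := Quot.lift (fun a : κ × Z.carrier => (F a.1).base a.2) (by
    rintro ⟨k, z⟩ ⟨l, w⟩ ⟨Φ, h, e⟩
    dsimp only at e h ⊢
    subst e
    rw [← hF k l Φ h]
    rfl)
  continuous_toFun := continuous_iSup_dom.2 fun k =>
    continuous_coinduced_dom.2 (F k).base.continuous

/-- The morphism out of a glued space given by a compatible family of morphisms. -/
def glueDesc : glue κ Z rel ⟶ X where
  base := glueDescBase F hF
  pull U := AlgHom.codRestrict (B := ∀ k : κ, Z.sec (U.comap (F k).base))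
    (AlgHom.pi (R := ℝ) (A := fun k : κ => Z.sec (U.comap (F k).base)) fun k => (F k).pull U)
    (glueSec (U.comap (glueDescBase F hF))) fun f k l Φ h => by
      have := same_of_hom_eq (hF k l Φ h) f
        (V := U.comap (F k).base) (by rw [hF k l Φ h]) le_rfl
      rw [Z.res_self] at this
      exact this
  pull_res h f := Subtype.ext (funext fun k => (F k).pull_res h f)
  pull_parity U f := Subtype.ext (funext fun k => (F k).pull_parity U f)

end desc

end glue

/-! ## Tangent and cotangent bundles -/

section bundles

variable {I J : Type} [Fintype I] [Fintype J] {X : SuperSpace}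

/-- The velocity function `ẋ^a ∂f/∂x^a` of a function `f` in the coordinates `(x^a, ẋ^a)` that a
chart of `X` induces on the tangent bundle. -/
def Chart.dot (φ : Chart I J X) {U : Opens X.carrier} (f : X.sec U) :
    (Model (I ⊕ I) (J ⊕ J)).sec (U.comap (doubleProj I J ≫ φ.hom).base) :=
  ∑ a : I ⊕ J, coord (U.comap (doubleProj I J ≫ φ.hom).base) (Sum.map Sum.inr Sum.inr a) *
    (doubleProj I J).pull (U.comap φ.hom.base) (partialDeriv (φ.hom.pull U f) a)

/-- The momentum function `Y^a p_a` of a vector field `Y` in the coordinates `(x^a, p_a)` that a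
chart of `X` induces on the cotangent bundle. -/
def Chart.momentum (φ : Chart I J X) {U : Opens X.carrier} (Y : VectorField X U) :
    (Model (I ⊕ I) (J ⊕ J)).sec (U.comap (doubleProj I J ≫ φ.hom).base) :=
  ∑ a : I ⊕ J, (doubleProj I J).pull (U.comap φ.hom.base) (φ.component Y a) *
    coord (U.comap (doubleProj I J ≫ φ.hom).base) (Sum.map Sum.inr Sum.inr a)

/-- `Φ` is the change of the coordinates on the tangent bundle induced by two charts `φ`, `ψ`, the
domain of `φ` being contained in that of `ψ`: it lies above the change of coordinates of `X`, and it
matches the velocity functions. If `x'^a` are the coordinate functions of `ψ`, the second condition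
for `f = x'^a` is the transformation law `ẋ'^a = ẋ^b ∂x'^a/∂x^b`; by the chain rule it follows for
all other `f`. -/
def TangentTransition (φ ψ : Chart I J X)
    (Φ : Model (I ⊕ I) (J ⊕ J) ⟶ Model (I ⊕ I) (J ⊕ J)) : Prop :=
  Φ ≫ doubleProj I J ≫ ψ.hom = doubleProj I J ≫ φ.hom ∧
    ∀ (U : Opens X.carrier) (f : X.sec U),
      (Model (I ⊕ I) (J ⊕ J)).Same (Φ.pull _ (ψ.dot f)) (φ.dot f)

/-- `Φ` is the change of the coordinates on the cotangent bundle induced by two charts `φ`, `ψ`, the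
domain of `φ` being contained in that of `ψ`: it lies above the change of coordinates of `X`, and it
matches the momentum functions. If `x'^a` are the coordinate functions of `ψ`, the second condition
for `Y = ∂/∂x'^a = (∂x^b/∂x'^a) ∂/∂x^b` is the transformation law `p'_a = (∂x^b/∂x'^a) p_b`; it
follows for all other `Y`. -/
def CotangentTransition (φ ψ : Chart I J X)
    (Φ : Model (I ⊕ I) (J ⊕ J) ⟶ Model (I ⊕ I) (J ⊕ J)) : Prop :=
  Φ ≫ doubleProj I J ≫ ψ.hom = doubleProj I J ≫ φ.hom ∧
    ∀ (U : Opens X.carrier) (Y : VectorField X U),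
      (Model (I ⊕ I) (J ⊕ J)).Same (Φ.pull _ (ψ.momentum Y)) (φ.momentum Y)

variable (I J X)

/-- The tangent bundle of a space with charts in `ℝ^{I|J}`, glued from the pieces `ℝ^{2I|2J}` with
coordinates `(x^a, ẋ^a)`, one for each chart. -/
def tangent : SuperSpace :=
  glue (Chart I J X) (Model (I ⊕ I) (J ⊕ J)) TangentTransition

/-- The cotangent bundle of a space with charts in `ℝ^{I|J}`, glued from the pieces `ℝ^{2I|2J}` with
coordinates `(x^a, p_a)`, one for each chart. -/
def cotangent : SuperSpace :=
  glue (Chart I J X) (Model (I ⊕ I) (J ⊕ J)) CotangentTransition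

/-- The bundle projection of the tangent bundle. -/
def tangentProj : tangent I J X ⟶ X :=
  glueDesc (fun φ => doubleProj I J ≫ φ.hom) fun _ _ _ h => h.1

/-- The bundle projection of the cotangent bundle. -/
def cotangentProj : cotangent I J X ⟶ X :=
  glueDesc (fun φ => doubleProj I J ≫ φ.hom) fun _ _ _ h => h.1

variable {X}

/-- The function `ḟ` on the tangent bundle induced by a function `f`; in particular `ẋ^a` for a
coordinate function `x^a`. -/
def dot {U : Opens X.carrier} (f : X.sec U) :
    (tangent I J X).sec (U.comap (tangentProj I J X).base) :=
  ⟨fun φ : Chart I J X => φ.dot f, fun _ _ _ h => (h.2 U f).2⟩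

/-- The function `p_Y` on the cotangent bundle induced by a vector field `Y`; in particular `p_a` for
a coordinate vector field `∂/∂x^a`. -/
def momentum {U : Opens X.carrier} (Y : VectorField X U) :
    (cotangent I J X).sec (U.comap (cotangentProj I J X).base) :=
  ⟨fun φ : Chart I J X => φ.momentum Y, fun _ _ _ h => (h.2 U Y).2⟩

variable {I J}

/-- The vertical lift `Y^a ∂/∂ẋ^a` to the tangent bundle of a vector field `Y = Y^a ∂/∂x^a`; the
vertical lift of `∂/∂x^a` is `∂/∂ẋ^a`. -/
structure IsVerticalLift {U : Opens X.carrier} (Y : VectorField X U)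
    (Z : VectorField (tangent I J X) (U.comap (tangentProj I J X).base)) : Prop where
  odd_eq : Z.odd = Y.odd
  app_pull : ∀ (V : Opens X.carrier) (hV : V ≤ U) (f : X.sec V),
    Z.app _ (comapLe _ hV) ((tangentProj I J X).pull V f) = 0
  app_dot : ∀ (V : Opens X.carrier) (hV : V ≤ U) (f : X.sec V),
    Z.app _ (comapLe _ hV) (dot I J f) = (tangentProj I J X).pull V (Y.app V hV f)

/-- The complete lift `Y^a ∂/∂x^a + Ẏ^a ∂/∂ẋ^a` to the tangent bundle of a vector field
`Y = Y^a ∂/∂x^a`; the complete lift of `∂/∂x^a` is the vector field `∂/∂x^a` of the induced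
coordinates `(x^a, ẋ^a)`. -/
structure IsCompleteLift {U : Opens X.carrier} (Y : VectorField X U)
    (Z : VectorField (tangent I J X) (U.comap (tangentProj I J X).base)) : Prop where
  odd_eq : Z.odd = Y.odd
  app_pull : ∀ (V : Opens X.carrier) (hV : V ≤ U) (f : X.sec V),
    Z.app _ (comapLe _ hV) ((tangentProj I J X).pull V f) =
      (tangentProj I J X).pull V (Y.app V hV f)
  app_dot : ∀ (V : Opens X.carrier) (hV : V ≤ U) (f : X.sec V),
    Z.app _ (comapLe _ hV) (dot I J f) = dot I J (Y.app V hV f)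

/-- `δ` is the differential `dF : X → T*X` of the function `F`: the section of the cotangent bundle
with `p_Y ∘ dF = Y F`, in coordinates `p_a ∘ dF = ∂F/∂x^a`. -/
structure IsDifferential (F : X.sec ⊤) (δ : X ⟶ cotangent I J X) : Prop where
  proj : δ ≫ cotangentProj I J X = 𝟙 X
  momentum : ∀ (U : Opens X.carrier) (Y : VectorField X U),
    X.Same (δ.pull _ (momentum I J Y)) (Y.app U le_rfl (X.res le_top F))

/-- `α` is the canonical isomorphism `TT*X → T*TX`. Applied to coordinate functions `f = x^a` and
coordinate vector fields `Y = ∂/∂x^a`, the conditions say that in the induced coordinates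
`(x, p, ẋ, ṗ)` on `TT*X` and, on `T*TX`, `(x, ẋ, q, r)` with `q_a`, `r_a` the momenta of `∂/∂x^a`,
`∂/∂ẋ^a`, one has `(x, ẋ, q, r) ∘ α = (x, ẋ, ṗ, p)`. -/
structure IsCanonicalIso
    (α : tangent (I ⊕ I) (J ⊕ J) (cotangent I J X) ≅
      cotangent (I ⊕ I) (J ⊕ J) (tangent I J X)) : Prop where
  proj : α.hom ≫ cotangentProj (I ⊕ I) (J ⊕ J) (tangent I J X) ≫ tangentProj I J X =
    tangentProj (I ⊕ I) (J ⊕ J) (cotangent I J X) ≫ cotangentProj I J X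
  dot : ∀ (U : Opens X.carrier) (f : X.sec U),
    SuperSpace.Same _
      (α.hom.pull _ ((cotangentProj (I ⊕ I) (J ⊕ J) (tangent I J X)).pull _ (dot I J f)))
      (dot (I ⊕ I) (J ⊕ J) ((cotangentProj I J X).pull U f))
  momentum_vertical : ∀ (U : Opens X.carrier) (Y : VectorField X U)
    (Z : VectorField (tangent I J X) (U.comap (tangentProj I J X).base)), IsVerticalLift Y Z →
    SuperSpace.Same _ (α.hom.pull _ (momentum (I ⊕ I) (J ⊕ J) Z))
      ((tangentProj (I ⊕ I) (J ⊕ J) (cotangent I J X)).pull _ (momentum I J Y))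
  momentum_complete : ∀ (U : Opens X.carrier) (Y : VectorField X U)
    (Z : VectorField (tangent I J X) (U.comap (tangentProj I J X).base)), IsCompleteLift Y Z →
    SuperSpace.Same _ (α.hom.pull _ (momentum (I ⊕ I) (J ⊕ J) Z))
      (SuperMech.dot (I ⊕ I) (J ⊕ J) (momentum I J Y))

end bundles

/-! ## The product with the time line and curves -/

section time

variable {S : SuperSpace}

/-- The inclusion `x ↦ (x, t)` of bodies. -/
def sliceMap (S : SuperSpace) (t : ℝ) : C(S.carrier, S.carrier × ℝ) := ⟨fun x => (x, t), by fun_prop⟩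

/-- The value at `(z, t)` of the pull-back along `θ : ℝ^{m|n} → S` of a family of sections of `S`
depending on time (extended by zero). -/
def plotValue {W : Opens (S.carrier × ℝ)} (s : ∀ t : ℝ, S.sec (W.comap (sliceMap S t))) {m n : ℕ}
    (θ : Model (Fin m) (Fin n) ⟶ S) (w : (Fin m → ℝ) × ℝ) : Grassmann (Fin n) :=
  extendZero (modelFun (θ.pull (W.comap (sliceMap S w.2)) (s w.2))) w.1

/-- The points `(z, t)` with `(θ z, t)` in `W`. -/
def plotDomain (W : Opens (S.carrier × ℝ)) {m n : ℕ} (θ : Model (Fin m) (Fin n) ⟶ S) :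
    Set ((Fin m → ℝ) × ℝ) :=
  {w | (θ.base w.1, w.2) ∈ W}

theorem plotDomain_isOpen (W : Opens (S.carrier × ℝ)) {m n : ℕ} (θ : Model (Fin m) (Fin n) ⟶ S) :
    IsOpen (plotDomain W θ) :=
  W.isOpen.preimage (f := fun w : (Fin m → ℝ) × ℝ => ((θ.base w.1, w.2) : S.carrier × ℝ))
    ((θ.base.continuous.comp continuous_fst).prodMk continuous_snd)

theorem plotValue_eq {W : Opens (S.carrier × ℝ)} (s : ∀ t : ℝ, S.sec (W.comap (sliceMap S t)))
    {m n : ℕ} (θ : Model (Fin m) (Fin n) ⟶ S) {w : (Fin m → ℝ) × ℝ} (hw : w ∈ plotDomain W θ) :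
    plotValue s θ w = modelFun (θ.pull (W.comap (sliceMap S w.2)) (s w.2)) ⟨w.1, hw⟩ :=
  extendZero_of_mem _ _

/-- The functions on `S × ℝ` over `W`: smooth families, indexed by time, of functions on `S`. For a
supermanifold `S` it amounts to the same to ask for smoothness of the pull-backs to all `ℝ^{m|n}`
or in charts of `S`, where it says that the family is a smooth function of the even coordinates of
`S` and of `t` with values in the Grassmann algebra of the odd coordinates of `S`. -/
def timeSec (S : SuperSpace) (W : Opens (S.carrier × ℝ)) :
    Subalgebra ℝ (∀ t : ℝ, S.sec (W.comap (sliceMap S t))) where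
  carrier := {s | ∀ (m n : ℕ) (θ : Model (Fin m) (Fin n) ⟶ S),
    SmoothOn (plotValue s θ) (plotDomain W θ)}
  mul_mem' {f g} hf hg m n θ := ((hf m n θ).mul (hg m n θ)).congr fun w hw => by
    rw [plotValue_eq _ _ hw, plotValue_eq _ _ hw, plotValue_eq _ _ hw, Pi.mul_apply, map_mul]
    rfl
  add_mem' {f g} hf hg m n θ := ((hf m n θ).add (hg m n θ)).congr fun w hw => by
    rw [plotValue_eq _ _ hw, plotValue_eq _ _ hw, plotValue_eq _ _ hw, Pi.add_apply, map_add]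
    rfl
  algebraMap_mem' r m n θ := (SmoothOn.const (algebraMap ℝ _ r)).congr fun w hw => by
    rw [plotValue_eq _ _ hw, Pi.algebraMap_apply, AlgHom.commutes]
    rfl

/-- The product `S × ℝ` of a supermanifold with the time line. -/
def timesLine (S : SuperSpace) : SuperSpace where
  carrier := S.carrier × ℝ
  sec W := timeSec S W
  parity W :=
    { toFun := fun s => ⟨fun t => S.parity _ (s.1 t), fun m n θ =>
        ((s.2 m n θ).linear (grassmannParity (Fin n)).toLinearMap).congr fun w hw => by
          rw [plotValue_eq _ _ hw, plotValue_eq _ _ hw, θ.pull_parity]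
          rfl⟩
      map_one' := Subtype.ext (funext fun _ => map_one (S.parity _))
      map_mul' := fun _ _ => Subtype.ext (funext fun _ => map_mul (S.parity _) _ _)
      map_zero' := Subtype.ext (funext fun _ => map_zero (S.parity _))
      map_add' := fun _ _ => Subtype.ext (funext fun _ => map_add (S.parity _) _ _)
      commutes' := fun r => Subtype.ext (funext fun _ => (S.parity _).commutes r) }
  parity_parity _ _ := Subtype.ext (funext fun _ => S.parity_parity _ _)
  res {W W'} hW :=
    { toFun := fun s => ⟨fun t => S.res (comapLe (sliceMap S t) hW) (s.1 t), fun m n θ l =>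
        ((s.2 m n θ l).mono fun w hw => hW hw).congr fun w hw => by
          rw [plotValue_eq _ _ hw, plotValue_eq _ _ (show w ∈ plotDomain W θ from hW hw),
            θ.pull_res]
          rfl⟩
      map_one' := Subtype.ext (funext fun _ => map_one (S.res _))
      map_mul' := fun _ _ => Subtype.ext (funext fun _ => map_mul (S.res _) _ _)
      map_zero' := Subtype.ext (funext fun _ => map_zero (S.res _))
      map_add' := fun _ _ => Subtype.ext (funext fun _ => map_add (S.res _) _ _)
      commutes' := fun r => Subtype.ext (funext fun _ => (S.res _).commutes r) }
  res_self _ _ := Subtype.ext (funext fun _ => S.res_self _ _)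
  res_res _ _ _ := Subtype.ext (funext fun _ => S.res_res _ _ _)
  res_parity _ _ := Subtype.ext (funext fun _ => S.res_parity _ _)
  locality {W} f g H := by
    refine Subtype.ext (funext fun t => S.locality _ _ fun x hx => ?_)
    obtain ⟨V, h, hx, e⟩ := H (x, t) hx
    exact ⟨V.comap (sliceMap S t), comapLe _ h, hx, congrFun (congrArg Subtype.val e) t⟩
  gluing {W μ} V hV cov s hs := by
    have ex : ∀ t, ∃ f : S.sec (W.comap (sliceMap S t)), ∀ k,
        S.res (comapLe (sliceMap S t) (hV k)) f = (s k).1 t := fun t =>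
      S.gluing (fun k => (V k).comap (sliceMap S t)) (fun k => comapLe _ (hV k))
        (fun z hz => cov _ hz) (fun k => (s k).1 t)
        (fun k l => congrFun (congrArg Subtype.val (hs k l)) t)
    choose f hf using ex
    refine ⟨⟨f, fun m n θ l w hw => ?_⟩, fun k => Subtype.ext (funext fun t => hf t k)⟩
    obtain ⟨k, hk⟩ := cov _ hw
    have hk' : plotDomain (V k) θ ∈ nhds w := (plotDomain_isOpen (V k) θ).mem_nhds hk
    refine ((((s k).2 m n θ l).contDiffAt hk').congr_of_eventuallyEq ?_).contDiffWithinAt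
    filter_upwards [hk'] with v hv
    rw [plotValue_eq _ _ hv, plotValue_eq _ _ (show v ∈ plotDomain W θ from hV k hv), ← hf v.2 k,
      θ.pull_res]
    rfl

/-- The time derivative of a function on `S × ℝ`, functions on `S` being constant in time. -/
def IsTimeDeriv {W : Opens (timesLine S).carrier} (s s' : (timesLine S).sec W) : Prop :=
  ∀ (m n : ℕ) (θ : Model (Fin m) (Fin n) ⟶ S) (l : Module.Dual ℝ (Grassmann (Fin n))) (z : Fin m → ℝ)
    (t : ℝ), (z, t) ∈ plotDomain W θ →
      HasDerivAt (fun r => l (plotValue (Subtype.val (p := (· ∈ timeSec S W)) s) θ (z, r)))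
        (l (plotValue (Subtype.val (p := (· ∈ timeSec S W)) s') θ (z, t))) t

/-- The inclusion of `S` into `S × ℝ` at time `t`. -/
def atTime (S : SuperSpace) (t : ℝ) : S ⟶ timesLine S where
  base := sliceMap S t
  pull W := (Pi.evalAlgHom ℝ (fun t => S.sec (W.comap (sliceMap S t))) t).comp (timeSec S W).val
  pull_res _ _ := rfl
  pull_parity _ _ := rfl

/-- The morphism `ψ × 1 : P × ℝ → S × ℝ`. -/
def timesLineMap {P S : SuperSpace} (ψ : P ⟶ S) : timesLine P ⟶ timesLine S where
  base := ψ.base.prodMap (ContinuousMap.id ℝ)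
  pull W :=
    { toFun := fun s => ⟨fun t => ψ.pull (W.comap (sliceMap S t))
          (Subtype.val (p := (· ∈ timeSec S W)) s t),
        fun m n θ => Subtype.property (p := (· ∈ timeSec S W)) s m n (θ ≫ ψ)⟩
      map_one' := Subtype.ext (funext fun _ => map_one (ψ.pull _))
      map_mul' := fun _ _ => Subtype.ext (funext fun _ => map_mul (ψ.pull _) _ _)
      map_zero' := Subtype.ext (funext fun _ => map_zero (ψ.pull _))
      map_add' := fun _ _ => Subtype.ext (funext fun _ => map_add (ψ.pull _) _ _)
      commutes' := fun r => Subtype.ext (funext fun _ => (ψ.pull _).commutes r) }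
  pull_res _ _ := Subtype.ext (funext fun _ => ψ.pull_res _ _)
  pull_parity _ _ := Subtype.ext (funext fun _ => ψ.pull_parity _ _)

/-- `τ : S × ℝ → TN` is the tangent prolongation of the `S`-curve `c : S × ℝ → N`: it lies above `c`
and `ḟ ∘ τ = d/dt (f ∘ c)` for all local functions `f` on `N`; for coordinate functions this is
`(x^a, ẋ^a) ∘ τ = (x^a ∘ c, d/dt (x^a ∘ c))`. -/
structure IsTangentProlongation {I J : Type} [Fintype I] [Fintype J] {N : SuperSpace}
    (c : timesLine S ⟶ N) (τ : timesLine S ⟶ tangent I J N) : Prop where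
  proj : τ ≫ tangentProj I J N = c
  dot : ∀ (U : Opens N.carrier) (f : N.sec U),
    IsTimeDeriv ((τ ≫ tangentProj I J N).pull U f) (τ.pull _ (dot I J f))

end time

/-! ## Phase dynamics -/

namespace Supermanifold

variable (M : Supermanifold)

/-- The tangent bundle `TM`. -/
abbrev T : SuperSpace := tangent (Fin M.evenDim) (Fin M.oddDim) M.space

/-- The cotangent bundle `T*M`. -/
abbrev Tstar : SuperSpace := cotangent (Fin M.evenDim) (Fin M.oddDim) M.space

/-- The bundle `TT*M`. -/
abbrev TTstar : SuperSpace :=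
  tangent (Fin M.evenDim ⊕ Fin M.evenDim) (Fin M.oddDim ⊕ Fin M.oddDim) M.Tstar

/-- The bundle `T*TM`. -/
abbrev TstarT : SuperSpace :=
  cotangent (Fin M.evenDim ⊕ Fin M.evenDim) (Fin M.oddDim ⊕ Fin M.oddDim) M.T

/-- A Lagrangian: an even function on the tangent bundle. -/
structure Lagrangian where
  toSec : M.T.sec ⊤
  even : M.T.parity ⊤ toSec = toSec

variable {M}

/-- The Tulczyjew differential `α⁻¹ ∘ dL : TM → TT*M` of a Lagrangian. -/
def IsTulczyjewDifferential (L : M.Lagrangian) (TL : M.T ⟶ M.TTstar) : Prop :=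
  ∃ (dL : M.T ⟶ M.TstarT) (α : M.TTstar ≅ M.TstarT),
    IsDifferential L.toSec dL ∧ IsCanonicalIso α ∧ TL = dL ≫ α.inv

/-- The `S`-points of the phase dynamics: the image of the `S`-points of `TM` under the Tulczyjew
differential. -/
def phaseDynamics (L : M.Lagrangian) (S : Supermanifold) : Set (S.space ⟶ M.TTstar) :=
  {n | ∃ TL : M.T ⟶ M.TTstar, IsTulczyjewDifferential L TL ∧ ∃ m : S.space ⟶ M.T, n = m ≫ TL}

/-- An `S`-curve in `T*M` is a solution of the phase dynamics at `S` if its tangent prolongation is in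
the phase dynamics for all times. -/
def IsPhaseSolution (L : M.Lagrangian) (S : Supermanifold) (c : timesLine S.space ⟶ M.Tstar) :
    Prop :=
  ∃ τ : timesLine S.space ⟶ M.TTstar, IsTangentProlongation c τ ∧
    ∀ t : ℝ, atTime S.space t ≫ τ ∈ phaseDynamics L S

end Supermanifold

end

end SuperMech

/-! The solution at `P` is obtained by base change. If `τ` is the tangent prolongation of an `S`-curve
`c`, then `(ψ × 1) ≫ τ` is the tangent prolongation of `(ψ × 1) ≫ c`, because pulling functions on
`S × ℝ` back along `ψ × 1` commutes with the time derivative (`IsTimeDeriv.pull_timesLineMap`).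
Restriction to time `t` commutes with `ψ` (`atTime_comp_timesLineMap`), so the restriction of the new
prolongation is `ψ` followed by `τ(t)`. The phase dynamics consists of morphisms `m ≫ TL`, and is
therefore stable under precomposition with `ψ` (`Supermanifold.comp_mem_phaseDynamics`). -/

namespace SuperMech

theorem atTime_comp_timesLineMap {P S : SuperSpace} (ψ : P ⟶ S) (t : ℝ) :
    atTime P t ≫ timesLineMap ψ = ψ ≫ atTime S t := rfl

/-- The time derivative is tested on the pull-backs along all `θ : ℝ^{m|n} ⟶ P`, and the pull-back
along `θ` of a function coming from `S × ℝ` is its pull-back along `θ ≫ ψ`. -/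
theorem IsTimeDeriv.pull_timesLineMap {P S : SuperSpace} (ψ : P ⟶ S)
    {W : Opens (timesLine S).carrier} {s s' : (timesLine S).sec W}
    (h : IsTimeDeriv s s') :
    IsTimeDeriv ((timesLineMap ψ).pull W s) ((timesLineMap ψ).pull W s') :=
  fun m n θ => h m n (θ ≫ ψ)

theorem IsTangentProlongation.timesLineMap_comp {I J : Type} [Fintype I] [Fintype J]
    {N P S : SuperSpace} (ψ : P ⟶ S) {c : timesLine S ⟶ N} {τ : timesLine S ⟶ tangent I J N}
    (h : IsTangentProlongation c τ) :
    IsTangentProlongation (timesLineMap ψ ≫ c) (timesLineMap ψ ≫ τ) where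
  proj := by rw [Category.assoc, h.proj]
  dot U f := (h.dot U f).pull_timesLineMap ψ

theorem Supermanifold.comp_mem_phaseDynamics {M : Supermanifold} {L : M.Lagrangian}
    {S P : Supermanifold} (ψ : P.space ⟶ S.space) {n : S.space ⟶ M.TTstar}
    (hn : n ∈ phaseDynamics L S) : ψ ≫ n ∈ phaseDynamics L P := by
  obtain ⟨TL, hTL, m, rfl⟩ := hn
  exact ⟨TL, hTL, ψ ≫ m, (Category.assoc ψ m TL).symm⟩

end SuperMech

theorem proposition3p1 (M : SuperMech.Supermanifold) (L : M.Lagrangian)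
    (S P : SuperMech.Supermanifold) (ψ : P.space ⟶ S.space)
    (c : SuperMech.timesLine S.space ⟶ M.Tstar)
    (hc : SuperMech.Supermanifold.IsPhaseSolution L S c) :
    SuperMech.Supermanifold.IsPhaseSolution L P (SuperMech.timesLineMap ψ ≫ c) := by
  obtain ⟨τ, hτ, hD⟩ := hc
  refine ⟨SuperMech.timesLineMap ψ ≫ τ, hτ.timesLineMap_comp ψ, fun t => ?_⟩
  rw [← Category.assoc, SuperMech.atTime_comp_timesLineMap, Category.assoc]
  exact SuperMech.Supermanifold.comp_mem_phaseDynamics ψ (hD t)
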